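/- Let $\mathbb{O}$ be the octonions and let $\mathfrak{h}_3(\mathbb{O})$ be the real vector space of hermitian $3\times 3$ octonionic matrices with the Jordan product $a\circ b=\frac12(ab+ba)$. Let $\mathfrak{h}_3^0(\mathbb{O})$ be the subspace of traceless matrices, and let $\mathbb{O}P^2=\{P\in\mathfrak{h}_3(\mathbb{O}) : P^2=P,\ \operatorname{tr}P=1\}$ be the Cayley plane, whose tangent space at $P$ is $T_P\mathbb{O}P^2=\{Z\in\mathfrak{h}_3(\mathbb{O}) : 2P\circ Z=Z\}$. Write $V^{\mathbb{C}}=V\otimes_{\mathbb{R}}\mathbb{C}$, and extend $\circ$ complex bilinearly and $\operatorname{tr}$ complex linearly to $\mathfrak{h}_3(\mathbb{O})^{\mathbb{C}}$. For $P\in\mathbb{O}P^2$ and $Z\in (T_P\mathbb{O}P^2)^{\mathbb{C}}$, let $\hat Z$ be the complex linear endomorphism of $\mathfrak{h}_3^0(\mathbb{O})^{\mathbb{C}}$ given by $$\hat Z(X)=-4\,Z\circ X+4\,Z\circ(P\circ X)+4\,P\circ(Z\circ X).$$ If $Z$ is isotropic, that is, $\operatorname{tr}(Z\circ Z)=0$,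 then $\hat Z$ is nilpotent and its nilorder, the least $r$ such that $\hat Z^r=0$, is at most $5$. -/

import Mathlib

open scoped Quaternion TensorProduct

noncomputable section

/-- The octonions, by the Cayley–Dickson construction: pairs of (Hamilton) quaternions. -/
@[ext]
structure Octonion where
  fst : ℍ[ℝ]
  snd : ℍ[ℝ]

namespace Octonion

/-- The underlying pair of quaternions. -/
def equivProd : Octonion ≃ ℍ[ℝ] × ℍ[ℝ] where
  toFun x := (x.fst, x.snd)
  invFun p := ⟨p.1, p.2⟩
  left_inv _ := rfl
  right_inv _ := rfl

/-- Componentwise addition. -/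
instance : AddCommGroup Octonion := equivProd.addCommGroup

/-- Componentwise real scalar multiplication. -/
instance : Module ℝ Octonion := equivProd.module ℝ

instance : One Octonion := ⟨⟨1, 0⟩⟩

/-- The Cayley–Dickson product `(a, b) (c, d) = (a c - d* b, d a + b c*)`. -/
instance : Mul Octonion :=
  ⟨fun x y => ⟨x.fst * y.fst - star y.snd * x.snd, y.snd * x.fst + x.snd * star y.fst⟩⟩

/-- Octonionic conjugation `(a, b)* = (a*, -b)`. -/
instance : Star Octonion := ⟨fun x => ⟨star x.fst, -x.snd⟩⟩

@[simp] theorem fst_zero : (0 : Octonion).fst = 0 := rfl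
@[simp] theorem snd_zero : (0 : Octonion).snd = 0 := rfl
@[simp] theorem fst_one : (1 : Octonion).fst = 1 := rfl
@[simp] theorem snd_one : (1 : Octonion).snd = 0 := rfl
@[simp] theorem fst_add (x y : Octonion) : (x + y).fst = x.fst + y.fst := rfl
@[simp] theorem snd_add (x y : Octonion) : (x + y).snd = x.snd + y.snd := rfl
@[simp] theorem fst_smul (r : ℝ) (x : Octonion) : (r • x).fst = r • x.fst := rfl
@[simp] theorem snd_smul (r : ℝ) (x : Octonion) : (r • x).snd = r • x.snd := rfl
@[simp] theorem fst_mul (x y : Octonion) :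
    (x * y).fst = x.fst * y.fst - star y.snd * x.snd := rfl
@[simp] theorem snd_mul (x y : Octonion) :
    (x * y).snd = y.snd * x.fst + x.snd * star y.fst := rfl
@[simp] theorem fst_star (x : Octonion) : (star x).fst = star x.fst := rfl
@[simp] theorem snd_star (x : Octonion) : (star x).snd = -x.snd := rfl

instance : NonAssocRing Octonion where
  left_distrib x y z := by
    ext1 <;> simp [mul_add, add_mul] <;> abel
  right_distrib x y z := by
    ext1 <;> simp [mul_add, add_mul] <;> abel
  zero_mul x := by ext1 <;> simp
  mul_zero x := by ext1 <;> simp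
  one_mul x := by ext1 <;> simp
  mul_one x := by ext1 <;> simp

instance : StarRing Octonion where
  star_involutive x := by ext1 <;> simp
  star_mul x y := by
    ext1
    · simp
    · simp
  star_add x y := by
    ext1
    · simp
    · simp; abel

instance : StarModule ℝ Octonion where
  star_smul r x := by ext1 <;> simp

instance : IsScalarTower ℝ Octonion Octonion where
  smul_assoc r x y := by ext1 <;> simp [smul_sub]

instance : SMulCommClass ℝ Octonion Octonion where
  smul_comm r x y := by ext1 <;> simp [smul_sub]

/-- The real part of an octonion. -/
def re : Octonion →ₗ[ℝ] ℝ where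
  toFun x := x.fst.re
  map_add' _ _ := rfl
  map_smul' _ _ := rfl

theorem re_apply (x : Octonion) : re x = x.fst.re := rfl

theorem re_mul_comm (x y : Octonion) : re (x * y) = re (y * x) := by
  simp [re_apply]; ring

theorem re_mul_assoc (x y z : Octonion) : re (x * y * z) = re (x * (y * z)) := by
  simp [re_apply]; ring

end Octonion

/-- `𝔥₃(𝕆)`: the real vector space of hermitian `3 × 3` octonionic matrices. -/
def H3O : Type := selfAdjoint (Matrix (Fin 3) (Fin 3) Octonion)

namespace H3O

instance : AddCommGroup H3O :=
  inferInstanceAs (AddCommGroup (selfAdjoint (Matrix (Fin 3) (Fin 3) Octonion)))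

instance : Module ℝ H3O :=
  inferInstanceAs (Module ℝ (selfAdjoint (Matrix (Fin 3) (Fin 3) Octonion)))

/-- The underlying octonionic matrix. -/
def toMatrix : H3O →ₗ[ℝ] Matrix (Fin 3) (Fin 3) Octonion where
  toFun a := a.1
  map_add' _ _ := rfl
  map_smul' _ _ := rfl

theorem toMatrix_injective : Function.Injective toMatrix := Subtype.val_injective

theorem conjTranspose_toMatrix (a : H3O) : (toMatrix a).conjTranspose = toMatrix a := a.2

/-- The Jordan product `a ∘ b = (a b + b a) / 2`, written `a * b`. -/
instance : Mul H3O :=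
  ⟨fun a b => ⟨(1 / 2 : ℝ) • (toMatrix a * toMatrix b + toMatrix b * toMatrix a), by
    have hmul : ∀ M N : Matrix (Fin 3) (Fin 3) Octonion, star (M * N) = star N * star M := by
      intro M N
      ext1 i j
      simp [Matrix.star_apply, Matrix.mul_apply, star_sum, star_mul]
    have ha : star (toMatrix a) = toMatrix a := a.2
    have hb : star (toMatrix b) = toMatrix b := b.2
    rw [selfAdjoint.mem_iff, star_smul, star_add, hmul, hmul, ha, hb, add_comm]
    simp⟩⟩

theorem toMatrix_mul (a b : H3O) :
    toMatrix (a * b) = (1 / 2 : ℝ) • (toMatrix a * toMatrix b + toMatrix b * toMatrix a) := rfl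

instance : NonUnitalNonAssocCommRing H3O where
  left_distrib a b c := toMatrix_injective <| by
    simp only [toMatrix_mul, map_add, mul_add, add_mul, ← smul_add]
    congr 1; abel
  right_distrib a b c := toMatrix_injective <| by
    simp only [toMatrix_mul, map_add, mul_add, add_mul, ← smul_add]
    congr 1; abel
  zero_mul a := toMatrix_injective <| by simp [toMatrix_mul]
  mul_zero a := toMatrix_injective <| by simp [toMatrix_mul]
  mul_comm a b := toMatrix_injective <| by simp only [toMatrix_mul, add_comm]

instance : IsScalarTower ℝ H3O H3O where
  smul_assoc r a b := toMatrix_injective <| by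
    simp only [smul_eq_mul, toMatrix_mul, map_smul, smul_mul_assoc, mul_smul_comm, ← smul_add,
      smul_comm r]

instance : SMulCommClass ℝ H3O H3O where
  smul_comm r a b := toMatrix_injective <| by
    simp only [smul_eq_mul, toMatrix_mul, map_smul, smul_mul_assoc, mul_smul_comm, ← smul_add,
      smul_comm r]

/-- The trace on `𝔥₃(𝕆)`, as a real number (the diagonal entries of a hermitian matrix are
real octonions). -/
def tr : H3O →ₗ[ℝ] ℝ :=
  Octonion.re ∘ₗ Matrix.traceLinearMap (Fin 3) ℝ Octonion ∘ₗ toMatrix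

theorem tr_mul_assoc (a b c : H3O) : tr (a * b * c) = tr (a * (b * c)) := by
  have hc : ∀ M N : Matrix (Fin 3) (Fin 3) Octonion,
      Octonion.re (M * N).trace = Octonion.re (N * M).trace := by
    intro M N
    simp only [Matrix.trace, Matrix.diag, Matrix.mul_apply, map_sum]
    rw [Finset.sum_comm]
    exact Finset.sum_congr rfl fun i _ => Finset.sum_congr rfl fun j _ =>
      Octonion.re_mul_comm _ _
  have hassoc : ∀ M N K : Matrix (Fin 3) (Fin 3) Octonion,
      Octonion.re (M * N * K).trace = Octonion.re (M * (N * K)).trace := by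
    intro M N K
    simp only [Matrix.trace, Matrix.diag, Matrix.mul_apply, Finset.sum_mul, Finset.mul_sum,
      map_sum, Octonion.re_mul_assoc]
    exact Finset.sum_congr rfl fun i _ => Finset.sum_comm
  have e1 := hassoc (toMatrix a) (toMatrix b) (toMatrix c)
  have e2 := hassoc (toMatrix b) (toMatrix a) (toMatrix c)
  have e3 := hc (toMatrix c) (toMatrix a * toMatrix b)
  have e4 := hc (toMatrix c) (toMatrix b * toMatrix a)
  have e5 := hassoc (toMatrix a) (toMatrix c) (toMatrix b)
  have e6 := hc (toMatrix a) (toMatrix b * toMatrix c)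
  have e7 := hc (toMatrix a) (toMatrix c * toMatrix b)
  have e8 := hc (toMatrix a * toMatrix c) (toMatrix b)
  have e9 := hassoc (toMatrix b) (toMatrix a) (toMatrix c)
  simp only [tr, LinearMap.comp_apply, Matrix.traceLinearMap_apply, toMatrix_mul,
    smul_mul_assoc, mul_smul_comm, mul_add, add_mul,
    map_add, map_smul, smul_eq_mul]
  linarith

/-- The Cayley plane `𝕆P²`: the matrices `P ∈ 𝔥₃(𝕆)` with `P² = P` (usual matrix product)
and `tr P = 1`. -/
def cayleyPlane : Set H3O :=
  {P | toMatrix P * toMatrix P = toMatrix P ∧ tr P = 1}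

/-- `𝔥₃⁰(𝕆)`: the traceless matrices. -/
def traceless : Submodule ℝ H3O := LinearMap.ker tr

/-- The tangent space `{Z | 2 P ∘ Z = Z}` of `𝕆P²` at `P`. -/
def tangentSpace (P : cayleyPlane) : Submodule ℝ H3O where
  carrier := {Z | (2 : ℝ) • ((P : H3O) * Z) = Z}
  zero_mem' := by simp
  add_mem' {a b} ha hb := by
    simp only [Set.mem_ofPred_eq] at ha hb ⊢
    rw [mul_add, smul_add, ha, hb]
  smul_mem' r a ha := by
    simp only [Set.mem_ofPred_eq] at ha ⊢
    rw [mul_smul_comm, smul_comm, ha]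

end H3O

/-- `𝔥₃(𝕆) ⊗ ℂ`, with the complex bilinear extension of the Jordan product as its
multiplication. -/
abbrev H3OC : Type := ℂ ⊗[ℝ] H3O

namespace H3OC

open H3O

/-- The complex linear extension of the trace. -/
def tr : H3OC →ₗ[ℂ] ℂ :=
  (TensorProduct.AlgebraTensorModule.rid ℝ ℂ ℂ).toLinearMap ∘ₗ H3O.tr.baseChange ℂ

/-- `𝔥₃⁰(𝕆)^ℂ`, as a complex subspace of `𝔥₃(𝕆)^ℂ`. -/
abbrev traceless : Submodule ℂ H3OC := H3O.traceless.baseChange ℂ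

/-- The complexified tangent space of `𝕆P²` at `P`, as a complex subspace of `𝔥₃(𝕆)^ℂ`. -/
abbrev tangentSpace (P : cayleyPlane) : Submodule ℂ H3OC := (H3O.tangentSpace P).baseChange ℂ

/-- A point of `𝕆P²`, regarded as an element of `𝔥₃(𝕆)^ℂ`. -/
def ofPoint (P : cayleyPlane) : H3OC := 1 ⊗ₜ[ℝ] (P : H3O)

/-- The linear map `X ↦ -4 Z ∘ X + 4 Z ∘ (P ∘ X) + 4 P ∘ (Z ∘ X)` on `𝔥₃(𝕆)^ℂ`. -/
def hatAux (P : cayleyPlane) (Z : H3OC) : H3OC →ₗ[ℂ] H3OC where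
  toFun X := (-4 : ℂ) • (Z * X) + (4 : ℂ) • (Z * (ofPoint P * X))
    + (4 : ℂ) • (ofPoint P * (Z * X))
  map_add' X Y := by simp only [mul_add, smul_add]; abel
  map_smul' c X := by
    simp only [mul_smul_comm, smul_add, RingHom.id_apply, smul_comm c]

theorem hatAux_mem (P : cayleyPlane) {Z : H3OC} (hZ : Z ∈ tangentSpace P)
    {X : H3OC} (hX : X ∈ traceless) : hatAux P Z X ∈ traceless := by
  have hadd : ∀ Z W Y : H3OC, hatAux P (Z + W) Y = hatAux P Z Y + hatAux P W Y := by
    intro Z W Y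
    simp only [hatAux, LinearMap.coe_mk, AddHom.coe_mk, add_mul, mul_add, smul_add]; abel
  have hsmul : ∀ (c : ℂ) (Z Y : H3OC), hatAux P (c • Z) Y = c • hatAux P Z Y := by
    intro c Z Y
    simp only [hatAux, LinearMap.coe_mk, AddHom.coe_mk, smul_mul_assoc, mul_smul_comm, smul_add,
      smul_comm c]
  rw [tangentSpace, Submodule.baseChange_eq_span] at hZ
  rw [traceless, Submodule.baseChange_eq_span] at hX
  induction hZ using Submodule.span_induction with
  | zero => simp [hatAux]
  | add Z W _ _ h1 h2 => rw [hadd]; exact add_mem h1 h2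
  | smul c Z _ h => rw [hsmul]; exact Submodule.smul_mem _ _ h
  | mem Z hZ =>
    obtain ⟨z, hz, rfl⟩ := hZ
    induction hX using Submodule.span_induction with
    | zero => simp
    | add X Y _ _ h1 h2 => rw [map_add]; exact add_mem h1 h2
    | smul c X _ h => rw [map_smul]; exact Submodule.smul_mem _ _ h
    | mem X hX =>
      obtain ⟨x, hx, rfl⟩ := hX
      have key : hatAux P (1 ⊗ₜ[ℝ] z) (1 ⊗ₜ[ℝ] x) = 1 ⊗ₜ[ℝ] ((-4 : ℝ) • (z * x)
          + (4 : ℝ) • (z * ((P : H3O) * x)) + (4 : ℝ) • ((P : H3O) * (z * x))) := by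
        simp only [hatAux, LinearMap.coe_mk, AddHom.coe_mk, ofPoint,
          Algebra.TensorProduct.tmul_mul_tmul, mul_one, TensorProduct.tmul_add,
          TensorProduct.tmul_smul]
        norm_num [TensorProduct.smul_tmul', TensorProduct.neg_tmul]
      change hatAux P (1 ⊗ₜ[ℝ] z) (1 ⊗ₜ[ℝ] x) ∈ _
      rw [key]
      refine Submodule.tmul_mem_baseChange_of_mem 1 ?_
      change H3O.tr _ = 0
      have hz' : (2 : ℝ) • ((P : H3O) * z) = z := hz
      have h1 : H3O.tr (z * x) = 2 * H3O.tr ((P : H3O) * z * x) := by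
        conv_lhs => rw [← hz']
        rw [smul_mul_assoc, map_smul, smul_eq_mul]
      have h2 : H3O.tr (z * ((P : H3O) * x)) = H3O.tr ((P : H3O) * z * x) := by
        rw [← tr_mul_assoc, mul_comm z]
      have h3 : H3O.tr ((P : H3O) * (z * x)) = H3O.tr ((P : H3O) * z * x) :=
        (tr_mul_assoc _ _ _).symm
      simp only [map_add, map_smul, smul_eq_mul, h1, h2, h3]
      ring

/-- The endomorphism `Ẑ(X) = -4 Z ∘ X + 4 Z ∘ (P ∘ X) + 4 P ∘ (Z ∘ X)` of `𝔥₃⁰(𝕆)^ℂ`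
associated with a complexified tangent vector `Z` of `𝕆P²` at `P`. -/
def hat (P : cayleyPlane) (Z : tangentSpace P) : Module.End ℂ traceless :=
  (hatAux P Z).restrict fun _ hX => hatAux_mem P Z.2 hX

end H3OC

end

/-!
The endomorphism `Ẑ` makes sense for an idempotent `P` of any Jordan algebra and an element `Z` of
its Peirce space `P Z = ½ Z`. With `z = L_Z` and `e = 2 L_P - 1`, which acts by `1, 0, -1` on the
three Peirce spaces of `P`, one has `Ẑ = 2 (z e + e z)`, and the Peirce relations read `e³ = e`,
`e z e = 0` and `z e² + e² z = z`. These alone give `(z e + e z)⁵ = z⁵ e + e z⁵`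
(`anticommutator_pow_five`), so it suffices to see that `L_Z⁵ = 0`.

For this, isotropy of `Z` gives `Z³ = 0`: a tangent vector has vanishing trace and `tr Z³ = 0`, so
that the Cayley–Hamilton identity of `𝔥₃(𝕆)` reduces to `Z³ = ½ tr(Z²) Z`. If `Z³ = 0`, the
multiplication operators `z = L_Z` and `w = L_{Z²}` commute and satisfy `3 z w = 2 z³` and
`w² = 2 z² w` by the linearised Jordan identity; computing `w² z` in two ways yields `z⁵ = 0`
(`pow_five_eq_zero`). The two facts combine in `LinearizedJordan.hat_pow_five`.

The Jordan and Cayley–Hamilton identities of `𝔥₃(𝕆)` both follow from the adjoint identity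
`x## = N(x) x` (`H3O.adj_adj`), which is checked in coordinates with the help of the Moufang
identity, together with associativity and definiteness of the trace form
(`CubicForm.jordan_identity`, `CubicForm.mul_self_mul_self`). The Jordan identity is carried over
to the complexification in its fully linearised form.
-/

noncomputable section

/-! ### Octonion identities -/

namespace Octonion

@[simp] theorem fst_sub (x y : Octonion) : (x - y).fst = x.fst - y.fst := rfl
@[simp] theorem snd_sub (x y : Octonion) : (x - y).snd = x.snd - y.snd := rfl
@[simp] theorem fst_neg (x : Octonion) : (-x).fst = -x.fst := rfl
@[simp] theorem snd_neg (x : Octonion) : (-x).snd = -x.snd := rfl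

/-- The squared Euclidean norm of an octonion, `n(x) = x x*`. -/
def normSq (x : Octonion) : ℝ := re (x * star x)

theorem self_mul_star (x : Octonion) : x * star x = normSq x • (1 : Octonion) := by
  ext <;> simp [normSq, re_apply] <;> ring

theorem star_mul_self (x : Octonion) : star x * x = normSq x • (1 : Octonion) := by
  ext <;> simp [normSq, re_apply] <;> ring

theorem mul_star_mul_star (x y : Octonion) : x * (star x * star y) = normSq x • star y := by
  ext <;> simp [normSq, re_apply] <;> ring

theorem star_mul_star_mul (x y : Octonion) : (star y * star x) * x = normSq x • star y := by
  ext <;> simp [normSq, re_apply] <;> ring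

set_option maxHeartbeats 2000000 in
/-- The middle Moufang identity `(x y)(z x) = x (y z) x`, with the right side written out by means
of the trace and the norm. -/
theorem moufang (x y z : Octonion) :
    (x * y) * (z * x) = (2 * re (x * y * z)) • x - normSq x • star (y * z) := by
  ext <;> simp [normSq, re_apply] <;> ring

/-- The norm of an off-diagonal entry of `x#`, needed for the diagonal entries of `x##`.
The case `r = 0` is the multiplicativity of the norm. -/
theorem normSq_star_mul_sub (r : ℝ) (x y z : Octonion) :
    normSq (star (y * z) - r • x)
      = normSq y * normSq z - 2 * r * re (x * y * z) + r ^ 2 * normSq x := by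
  simp [normSq, re_apply]; ring

theorem normSq_eq (x : Octonion) : normSq x =
    x.fst.re ^ 2 + x.fst.imI ^ 2 + x.fst.imJ ^ 2 + x.fst.imK ^ 2
      + x.snd.re ^ 2 + x.snd.imI ^ 2 + x.snd.imJ ^ 2 + x.snd.imK ^ 2 := by
  simp [normSq, re_apply]; ring

theorem normSq_nonneg (x : Octonion) : 0 ≤ normSq x := by
  rw [normSq_eq]; positivity

theorem normSq_eq_zero {x : Octonion} (h : normSq x = 0) : x = 0 := by
  rw [normSq_eq] at h
  ext <;> simp <;> nlinarith [sq_nonneg x.fst.re, sq_nonneg x.fst.imI, sq_nonneg x.fst.imJ,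
    sq_nonneg x.fst.imK, sq_nonneg x.snd.re, sq_nonneg x.snd.imI, sq_nonneg x.snd.imJ,
    sq_nonneg x.snd.imK]

theorem eq_re_smul_one_of_star_eq {x : Octonion} (h : star x = x) :
    x = re x • (1 : Octonion) := by
  have h1 := congrArg (fun y => y.fst.imI) h
  have h2 := congrArg (fun y => y.fst.imJ) h
  have h3 := congrArg (fun y => y.fst.imK) h
  have h4 := congrArg (fun y => y.snd.re) h
  have h5 := congrArg (fun y => y.snd.imI) h
  have h6 := congrArg (fun y => y.snd.imJ) h
  have h7 := congrArg (fun y => y.snd.imK) h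
  simp at h1 h2 h3 h4 h5 h6 h7
  ext <;> simp [re_apply] <;> linarith

/-- An off-diagonal entry of `x## = N(x) x` for a hermitian matrix `x` with diagonal entries
`r, s, t` and off-diagonal entries `a, b, c`. -/
theorem star_mul_adjoint_entries (r s t : ℝ) (a b c : Octonion) :
    star ((star (c * a) - s • b) * (star (a * b) - t • c))
        - (s * t - normSq a) • (star (b * c) - r • a)
      = (r * s * t - r * normSq a - s * normSq b - t * normSq c + 2 * re (a * b * c)) • a := by
  have h : (star (c * a) - s • b) * (star (a * b) - t • c) = star (c * a) * star (a * b)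
      - (t * normSq c) • star a - (s * normSq b) • star a + (s * t) • (b * c) := by
    have h1 := mul_star_mul_star b a
    have h2 := star_mul_star_mul c a
    rw [← star_mul] at h1 h2
    simp only [sub_mul, mul_sub, smul_mul_assoc, mul_smul_comm, h1, h2]
    module
  rw [h, star_add, star_sub, star_sub, star_mul (star (c * a)), star_star, star_star, moufang]
  simp only [star_smul, star_star, star_trivial]
  module

theorem re_mul_cycle (a b c : Octonion) : re (b * c * a) = re (a * b * c) := by
  rw [re_mul_comm, re_mul_assoc]

theorem re_star_mul_sub_mul_star (r : ℝ) (a b c : Octonion) :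
    re ((star (b * c) - r • a) * star a) = re (a * b * c) - r * normSq a := by
  simp [re_apply, normSq]; ring

end Octonion

/-! ### Commutative algebras with a cubic adjoint identity -/

namespace CubicForm

variable {A : Type*} [NonUnitalNonAssocCommRing A] [Module ℝ A]

/-- The polarisation `x × y` of the quadratic adjoint
`x# = x² - T(x) x + ½ (T(x)² - T(x²)) u` attached to a linear form `T` and an element `u` of a
commutative algebra, so that `x × x = 2 x#`. -/
def cross (T : A →ₗ[ℝ] ℝ) (u x y : A) : A :=
  (2 : ℝ) • (x * y) - T x • y - T y • x + (T x * T y - T (x * y)) • u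

/-- The quadratic adjoint `x#`. -/
def adj (T : A →ₗ[ℝ] ℝ) (u x : A) : A :=
  x * x - T x • x + ((T x ^ 2 - T (x * x)) / 2) • u

/-- The cubic norm, `N(x) = ⅓ T(x# x)`. -/
def norm (T : A →ₗ[ℝ] ℝ) (u x : A) : ℝ := T (adj T u x * x) / 3

variable (T : A →ₗ[ℝ] ℝ) (u : A)

theorem cross_comm (x y : A) : cross T u x y = cross T u y x := by
  simp only [cross, mul_comm y x]; module

theorem cross_add_right (x y z : A) :
    cross T u x (y + z) = cross T u x y + cross T u x z := by
  simp only [cross, mul_add, map_add]; module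

theorem cross_self (x : A) : cross T u x x = (2 : ℝ) • adj T u x := by
  simp only [cross, adj]; module

theorem adj_add (x y : A) : adj T u (x + y) = adj T u x + cross T u x y + adj T u y := by
  simp only [cross, adj, mul_add, add_mul, map_add, mul_comm y x]; module

variable {T u}

/-- `T((x × y) z)` is symmetric in its three arguments. -/
theorem trace_cross_mul [IsScalarTower ℝ A A] (hu : ∀ x, u * x = x)
    (hT : ∀ x y z, T (x * y * z) = T (x * (y * z))) (x y z : A) :
    T (cross T u x y * z) = T (cross T u x z * y) := by
  have h : T (x * y * z) = T (x * z * y) := by rw [hT, hT, mul_comm y]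
  simp only [cross, add_mul, sub_mul, smul_mul_assoc, map_add, map_sub, map_smul, smul_eq_mul,
    hu, h, mul_comm z y]
  ring

variable (T u) in
theorem cross_smul_right [SMulCommClass ℝ A A] (r : ℝ) (x y : A) :
    cross T u x (r • y) = r • cross T u x y := by
  simp only [cross, mul_smul_comm, map_smul, smul_eq_mul]; module

variable [IsScalarTower ℝ A A] [SMulCommClass ℝ A A]

variable (T u) in
theorem adj_smul (r : ℝ) (x : A) : adj T u (r • x) = r ^ 2 • adj T u x := by
  simp only [adj, mul_smul_comm, smul_mul_assoc, map_smul, smul_eq_mul]; module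

/-- The Taylor expansion of the norm; its differential at `x` is `y ↦ T(x# y)`. -/
theorem norm_add_smul (hu : ∀ x, u * x = x) (hT : ∀ x y z, T (x * y * z) = T (x * (y * z)))
    (t : ℝ) (x y : A) : norm T u (x + t • y) = norm T u x + t * T (adj T u x * y)
      + t ^ 2 * T (adj T u y * x) + t ^ 3 * norm T u y := by
  have h1 := trace_cross_mul hu hT x y x
  have h2 := trace_cross_mul hu hT y x y
  rw [cross_self, smul_mul_assoc, map_smul, smul_eq_mul] at h1 h2
  rw [cross_comm] at h2
  simp only [norm, adj_add, adj_smul, cross_smul_right, add_mul, mul_add, mul_smul_comm,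
    smul_mul_assoc, map_add, map_smul, smul_eq_mul]
  rw [h1, h2]
  ring

/-- A polynomial of degree at most four with vector coefficients which vanishes identically has
no linear term. -/
theorem linear_coeff_eq_zero {V : Type*} [AddCommGroup V] [Module ℝ V] {a b c d e : V}
    (h : ∀ t : ℝ, a + t • b + t ^ 2 • c + t ^ 3 • d + t ^ 4 • e = 0) : b = 0 := by
  have h1 := h 1
  have h2 := h (-1)
  have h3 := h 2
  have h4 := h (-2)
  -- The finite difference `(8 (f(1) - f(-1)) - (f(2) - f(-2))) / 12` is exact in degree four.
  have : b = (2 / 3 : ℝ) • (a + (1 : ℝ) • b + (1 : ℝ) ^ 2 • c + (1 : ℝ) ^ 3 • d + (1 : ℝ) ^ 4 • e)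
      - (2 / 3 : ℝ) • (a + (-1 : ℝ) • b + (-1 : ℝ) ^ 2 • c + (-1 : ℝ) ^ 3 • d + (-1 : ℝ) ^ 4 • e)
      - (1 / 12 : ℝ) • (a + (2 : ℝ) • b + (2 : ℝ) ^ 2 • c + (2 : ℝ) ^ 3 • d + (2 : ℝ) ^ 4 • e)
      + (1 / 12 : ℝ) • (a + (-2 : ℝ) • b + (-2 : ℝ) ^ 2 • c + (-2 : ℝ) ^ 3 • d
        + (-2 : ℝ) ^ 4 • e) := by
    module
  rw [this, h1, h2, h3, h4]
  simp

/-- The linearisation of the adjoint identity `x## = N(x) x`. -/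
theorem cross_adj_cross (hu : ∀ x, u * x = x) (hT : ∀ x y z, T (x * y * z) = T (x * (y * z)))
    (hadj : ∀ x, adj T u (adj T u x) = norm T u x • x) (x y : A) :
    cross T u (adj T u x) (cross T u x y)
      = norm T u x • y + T (adj T u x * y) • x := by
  -- The adjoint identity at `x + t y`, sorted by powers of `t`.
  have key : ∀ t : ℝ,
      (0 : A) + t • (cross T u (adj T u x) (cross T u x y)
          - (norm T u x • y + T (adj T u x * y) • x))
        + t ^ 2 • (adj T u (cross T u x y) + cross T u (adj T u x) (adj T u y)
          - (T (adj T u x * y) • y + T (adj T u y * x) • x))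
        + t ^ 3 • (cross T u (cross T u x y) (adj T u y)
          - (T (adj T u y * x) • y + norm T u y • x))
        + t ^ 4 • (0 : A) = 0 := by
    intro t
    have h := hadj (x + t • y)
    rw [norm_add_smul hu hT, adj_add, adj_smul, cross_smul_right, adj_add, adj_add,
      adj_smul, adj_smul, hadj, hadj] at h
    simp only [cross_smul_right, cross_comm T u _ (t ^ 2 • adj T u y), cross_add_right] at h
    rw [cross_comm T u (t ^ 2 • adj T u y), cross_comm T u (t ^ 2 • adj T u y),
      cross_smul_right, cross_smul_right] at h
    rw [← sub_eq_zero] at h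
    refine Eq.trans ?_ h
    module
  exact sub_eq_zero.1 (linear_coeff_eq_zero key)

/-- The identity dual to `cross_adj_cross` with respect to the trace form. -/
theorem cross_cross_adj (hu : ∀ x, u * x = x) (hT : ∀ x y z, T (x * y * z) = T (x * (y * z)))
    (hpos : ∀ x, T (x * x) = 0 → x = 0)
    (hadj : ∀ x, adj T u (adj T u x) = norm T u x • x) (x y : A) :
    cross T u x (cross T u (adj T u x) y)
      = norm T u x • y + T (x * y) • adj T u x := by
  have key : ∀ z, T ((cross T u x (cross T u (adj T u x) y)
      - (norm T u x • y + T (x * y) • adj T u x)) * z) = 0 := by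
    intro z
    rw [sub_mul, map_sub, trace_cross_mul hu hT, mul_comm, trace_cross_mul hu hT,
      cross_adj_cross hu hT hadj]
    simp only [add_mul, smul_mul_assoc, map_add, map_smul, smul_eq_mul, mul_comm z y]
    ring
  exact sub_eq_zero.1 (hpos _ (key _))

/-- A commutative algebra with an associative anisotropic trace form whose adjoint satisfies
`x## = N(x) x` is a Jordan algebra. -/
theorem jordan_identity (hu : ∀ x, u * x = x) (hu3 : T u = 3)
    (hT : ∀ x y z, T (x * y * z) = T (x * (y * z)))
    (hpos : ∀ x, T (x * x) = 0 → x = 0)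
    (hadj : ∀ x, adj T u (adj T u x) = norm T u x • x) (x y : A) :
    x * (x * x * y) = x * x * (x * y) := by
  have h1 := cross_adj_cross hu hT hadj x y
  have h2 := cross_cross_adj hu hT hpos hadj x y
  have hx : x * x = adj T u x + T x • x - ((T x ^ 2 - T (x * x)) / 2) • u := by
    simp only [adj]; module
  -- The defect `x (q y) - q (x y)`, with `q = x#`, is a combination of `h1` and `h2` and of the
  -- following trace identity.
  have h3 : T (x * (adj T u x * y)) = T (adj T u x * (x * y)) := by
    rw [← hT, ← hT, mul_comm x]
  rw [hx]
  generalize adj T u x = q at *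
  simp only [cross, add_mul, sub_mul, mul_add, mul_sub, smul_mul_assoc, mul_smul_comm, map_add,
    map_sub, map_smul, smul_eq_mul, mul_comm x u, hu, mul_comm q u, mul_comm q x, h3, hu3]
    at h1 h2 ⊢
  linear_combination (norm := module) (1 / 4 : ℝ) • h2 - (1 / 4 : ℝ) • h1

/-- The Cayley–Hamilton identity for elements of vanishing trace and norm; it is the case `y = u`
of `x × (x# × y) = N(x) y + T(x y) x#`. -/
theorem mul_self_mul_self (hu : ∀ x, u * x = x) (hu3 : T u = 3)
    (hT : ∀ x y z, T (x * y * z) = T (x * (y * z)))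
    (hpos : ∀ x, T (x * x) = 0 → x = 0)
    (hadj : ∀ x, adj T u (adj T u x) = norm T u x • x) {x : A} (h1 : T x = 0)
    (h3 : T (x * x * x) = 0) : x * x * x = (T (x * x) / 2) • x := by
  have h := cross_cross_adj hu hT hpos hadj x u
  have hn : norm T u x = 0 := by
    simp only [norm, adj, h1, zero_smul, add_mul, smul_mul_assoc, hu, map_add, map_smul, h3,
      sub_zero, smul_zero, add_zero, zero_div]
  rw [hn] at h
  simp only [cross, adj, h1, zero_smul, sub_zero, add_mul, mul_add, mul_sub,
    mul_smul_comm, hu, mul_comm x u, mul_comm _ u, map_add, map_sub, map_smul, h3, smul_eq_mul,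
    hu3, mul_comm x (x * x)] at h
  linear_combination (norm := module) (-1 / 2 : ℝ) • h

end CubicForm

/-! ### Nilpotency in associative rings and multiplication operators of Jordan algebras -/

/-- In an associative ring, the relations `e z e = 0`, `e³ = e` and `e² z + z e² = z` reduce the
fifth power of the anticommutator `z e + e z` to that of `z`. -/
theorem anticommutator_pow_five {R : Type*} [Ring R] {e z : R} (h1 : e * z * e = 0)
    (h3 : e * e * e = e) (h2 : z * (e * e) + e * e * z = z) :
    (z * e + e * z) ^ 5 = z ^ 5 * e + e * z ^ 5 := by
  -- `e²` commutes with `z²`, although not with `z`.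
  have hc : e * e * (z * z) = z * z * (e * e) := by
    have h : e * e * z = z - z * (e * e) := eq_sub_of_add_eq' h2
    calc e * e * (z * z) = e * e * z * z := by rw [mul_assoc (e * e)]
      _ = z * z - z * (e * e * z) := by rw [h, sub_mul]; simp only [mul_assoc, h]
      _ = z * z * (e * e) := by rw [h]; noncomm_ring
  have hA : z * e * (z * e) = 0 := by
    rw [mul_assoc, ← mul_assoc e, h1, mul_zero]
  have hB : e * z * (e * z) = 0 := by
    rw [← mul_assoc, h1, zero_mul]
  -- As `z e` and `e z` square to zero, only the alternating words survive in the fifth power.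
  have hAB : ∀ A B : R, A * A = 0 → B * B = 0 →
      (A + B) ^ 5 = A * B * A * B * A + B * A * B * A * B := by
    intro A B hA hB
    simp only [pow_succ, pow_zero, one_mul, add_mul, mul_add, mul_assoc, hA, hB,
      mul_zero, add_zero, zero_add]
  rw [hAB _ _ hA hB]
  congr 1
  · calc z * e * (e * z) * (z * e) * (e * z) * (z * e)
        = z * (e * e * (z * z)) * (e * e * (z * z)) * e := by simp only [mul_assoc]
      _ = z * (z * z * (e * e)) * (z * z * (e * e)) * e := by rw [hc]
      _ = z * (z * z) * (e * e * (z * z)) * (e * e * e) := by simp only [mul_assoc]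
      _ = z * (z * z) * (z * z * (e * e)) * e := by rw [hc, h3]
      _ = z * (z * z) * (z * z) * (e * e * e) := by simp only [mul_assoc]
      _ = z ^ 5 * e := by rw [h3]; simp only [pow_succ, pow_zero, one_mul, mul_assoc]
  · calc e * z * (z * e) * (e * z) * (z * e) * (e * z)
        = e * (z * z * (e * e)) * (z * z * (e * e)) * z := by simp only [mul_assoc]
      _ = e * (e * e * (z * z)) * (e * e * (z * z)) * z := by rw [hc]
      _ = e * e * e * (z * z * (e * e)) * (z * z) * z := by simp only [mul_assoc]
      _ = e * (e * e * (z * z)) * (z * z) * z := by rw [hc, h3]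
      _ = e * e * e * (z * z) * (z * z) * z := by simp only [mul_assoc]
      _ = e * z ^ 5 := by rw [h3]; simp only [pow_succ, pow_zero, one_mul, mul_assoc]

/-- If `z` and `w` commute with `3 z w = 2 z³` and `w² = z² w + w z²`, then `z` is nilpotent:
computing `w² z` in two ways gives `(4/3) z⁵ = (4/9) z⁵`. -/
theorem pow_five_eq_zero {R : Type*} [Ring R] [Algebra ℂ R] {z w : R} (hc : w * z = z * w)
    (h1 : (3 : ℂ) • (z * w) = (2 : ℂ) • z ^ 3) (h2 : w * w = z * z * w + w * (z * z)) :
    z ^ 5 = 0 := by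
  have h1 : z * w = (2 / 3 : ℂ) • z ^ 3 := by
    have := congrArg ((1 / 3 : ℂ) • ·) h1
    simp only [smul_smul] at this
    norm_num at this
    exact this
  have hw2 : w * w = (4 / 3 : ℂ) • z ^ 4 := by
    have : w * w = z * (z * w) + w * z * z := by rw [h2]; noncomm_ring
    rw [this, hc, h1, mul_smul_comm, smul_mul_assoc, ← pow_succ, ← pow_succ', ← add_smul]
    norm_num
  have e1 : w * w * z = (4 / 3 : ℂ) • z ^ 5 := by
    rw [hw2, smul_mul_assoc, ← pow_succ]
  have e2 : w * w * z = (4 / 9 : ℂ) • z ^ 5 := by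
    have : w * z ^ 3 = (2 / 3 : ℂ) • z ^ 5 := by
      calc w * z ^ 3 = w * z * z ^ 2 := by noncomm_ring
        _ = (2 / 3 : ℂ) • z ^ 5 := by rw [hc, h1, smul_mul_assoc, ← pow_add]
    rw [mul_assoc, hc, h1, mul_smul_comm, this, smul_smul]
    norm_num
  have h : ((4 / 3 : ℂ) - 4 / 9) • z ^ 5 = 0 := by rw [sub_smul, ← e1, ← e2, sub_self]
  exact (smul_eq_zero.1 h).resolve_left (by norm_num)

section Jordan

variable {A : Type*} [NonUnitalNonAssocCommRing A]

/-- The full linearisation `[L_{ab}, L_c] + [L_{bc}, L_a] + [L_{ca}, L_b] = 0` of the Jordan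
identity. -/
def LinearizedJordan (A : Type*) [NonUnitalNonAssocCommRing A] : Prop :=
  ∀ a b c d : A, a * b * (c * d) + b * c * (a * d) + c * a * (b * d)
    = c * (a * b * d) + a * (b * c * d) + b * (c * a * d)

section

attribute [local instance] LieRing.ofAssociativeRing

theorem linearizedJordan_of_isCommJordan [IsCommJordan A] [IsAddTorsionFree A] :
    LinearizedJordan A := by
  intro a b c d
  have h := DFunLike.congr_fun (two_nsmul_lie_lmul_lmul_add_add_eq_zero a b c) d
  change 2 • (a * (b * c * d) - b * c * (a * d) + (b * (c * a * d) - c * a * (b * d))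
    + (c * (a * b * d) - a * b * (c * d))) = 0 at h
  rw [smul_eq_zero_iff_right (by norm_num)] at h
  rw [← sub_eq_zero, ← neg_eq_zero, ← h]
  abel

end

/-- Since the left side of the linearised Jordan identity is symmetric in all four variables, so
is the right side. -/
theorem LinearizedJordan.mul_apply_eq (h : LinearizedJordan A) (a b c d : A) :
    c * (a * b * d) + a * (b * c * d) + b * (c * a * d)
      = a * b * c * d + a * (c * (b * d)) + b * (c * (a * d)) := by
  have h2 : a * b * (c * d) + b * c * (a * d) + c * a * (b * d)
      = a * b * (d * c) + b * d * (a * c) + d * a * (b * c) := by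
    rw [mul_comm c d, mul_comm (b * c), mul_comm a d, mul_comm (c * a), mul_comm c a]
    abel
  rw [← h, h2, h, mul_comm d (a * b * c), mul_comm (b * d) c, mul_comm (d * a) c, mul_comm d a]

/-- The square of an element of the Peirce space `P Z = ½ Z` has no component in that space: it lies
in the sum of the Peirce spaces for `0` and `1`. -/
theorem LinearizedJordan.mul_mul_sq (h : LinearizedJordan A) [Module ℝ A] [IsScalarTower ℝ A A]
    [SMulCommClass ℝ A A] {P Z : A} (hP : P * P = P) (hZ : P * Z = (1 / 2 : ℝ) • Z) :
    P * (P * (Z * Z)) = P * (Z * Z) := by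
  have h1 := h.mul_apply_eq P Z P Z
  rw [mul_comm Z P, hZ] at h1
  simp only [smul_mul_assoc, mul_smul_comm, hP, hZ, mul_comm Z P] at h1
  rw [← sub_eq_zero] at h1 ⊢
  rw [← neg_eq_zero, ← h1]
  module

variable [Module ℂ A] [IsScalarTower ℂ A A] [SMulCommClass ℂ A A]

open LinearMap

/-- Let `P` be an idempotent of a Jordan algebra and `Z` an element of its Peirce space for `½` with
`Z³ = 0`. Then the fifth power of `-4 L_Z + 4 L_Z L_P + 4 L_P L_Z` vanishes. -/
theorem LinearizedJordan.hat_pow_five (h : LinearizedJordan A) {P Z : A} (hP : P * P = P)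
    (hZ : P * Z = (1 / 2 : ℂ) • Z) (hZ3 : Z * Z * Z = 0) :
    ((-4 : ℂ) • mulLeft ℂ Z + (4 : ℂ) • (mulLeft ℂ Z * mulLeft ℂ P)
      + (4 : ℂ) • (mulLeft ℂ P * mulLeft ℂ Z)) ^ 5 = 0 := by
  have hZ' : Z * P = (1 / 2 : ℂ) • Z := by rw [mul_comm, hZ]
  set z : Module.End ℂ A := mulLeft ℂ Z with hz
  set p : Module.End ℂ A := mulLeft ℂ P with hp
  set w : Module.End ℂ A := mulLeft ℂ (Z * Z) with hw
  have hz5 : z ^ 5 = 0 := by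
    apply pow_five_eq_zero (w := w)
    · ext d
      have h1 := h Z Z Z d
      have h2 : (3 : ℂ) • (Z * Z * (Z * d)) = (3 : ℂ) • (Z * (Z * Z * d)) := by
        linear_combination (norm := module) h1
      exact smul_right_injective A (by norm_num : (3 : ℂ) ≠ 0) h2
    · ext d
      have h1 := h.mul_apply_eq Z Z Z d
      rw [hZ3, zero_mul] at h1
      simp only [hz, hw, LinearMap.smul_apply, pow_succ, pow_zero, one_mul, Module.End.mul_apply,
        mulLeft_apply]
      linear_combination (norm := module) h1
    · ext d
      have h1 := h.mul_apply_eq Z (Z * Z) Z d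
      rw [mul_comm Z (Z * Z), hZ3] at h1
      simp only [hz, hw, LinearMap.add_apply, Module.End.mul_apply, mulLeft_apply]
      simp only [zero_mul, mul_zero, zero_add] at h1
      linear_combination (norm := module) h1
  -- The Peirce relations of `L_P` with itself and with `L_Z`.
  have hp3 : (2 : ℂ) • (p * p * p) + p = (3 : ℂ) • (p * p) := by
    ext d
    have h1 := h.mul_apply_eq P P P d
    rw [hP, hP] at h1
    simp only [hp, LinearMap.add_apply, LinearMap.smul_apply, Module.End.mul_apply,
      mulLeft_apply]
    linear_combination (norm := module) -h1
  have hpzp : (2 : ℂ) • (p * z * p) + (1 / 2 : ℂ) • z = z * p + p * z := by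
    ext d
    have h1 := h.mul_apply_eq P P Z d
    simp only [hP, hZ, hZ', smul_mul_assoc, mul_smul_comm] at h1
    simp only [hp, hz, LinearMap.add_apply, LinearMap.smul_apply, Module.End.mul_apply,
      mulLeft_apply]
    linear_combination (norm := module) -h1
  have hzpp : z * (p * p) + p * p * z + (1 / 4 : ℂ) • z = z * p + p * z := by
    ext d
    have h1 := h.mul_apply_eq P Z P d
    simp only [hP, hZ, hZ', smul_mul_assoc, mul_smul_comm] at h1
    simp only [hp, hz, LinearMap.add_apply, LinearMap.smul_apply, Module.End.mul_apply,
      mulLeft_apply]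
    linear_combination (norm := module) -h1
  clear_value z p w
  -- `e` acts by `1`, `0`, `-1` on the Peirce spaces of `P` for `1`, `½`, `0`.
  set e : Module.End ℂ A := (2 : ℂ) • p - 1 with he
  have h3 : e * e * e = e := by
    simp only [he, sub_mul, mul_sub, smul_mul_assoc, mul_smul_comm, one_mul, mul_one]
    linear_combination (norm := module) (4 : ℂ) • hp3
  have h1 : e * z * e = 0 := by
    simp only [he, sub_mul, mul_sub, smul_mul_assoc, mul_smul_comm, one_mul, mul_one]
    linear_combination (norm := module) (2 : ℂ) • hpzp
  have h2 : z * (e * e) + e * e * z = z := by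
    simp only [he, sub_mul, mul_sub, smul_mul_assoc, mul_smul_comm, one_mul, mul_one]
    simp only [← mul_assoc] at hzpp ⊢
    linear_combination (norm := module) (4 : ℂ) • hzpp
  have hh : (-4 : ℂ) • z + (4 : ℂ) • (z * p) + (4 : ℂ) • (p * z)
      = (2 : ℂ) • (z * e + e * z) := by
    simp only [he, sub_mul, mul_sub, smul_mul_assoc, mul_smul_comm, one_mul, mul_one]
    module
  rw [hh, smul_pow, anticommutator_pow_five h1 h3 h2, hz5, zero_mul, mul_zero, add_zero,
    smul_zero]

end Jordan

/-! ### The Jordan algebra of hermitian octonionic matrices -/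

namespace H3O

open Octonion

/-- The hermitian matrix with diagonal entries `r`, `s`, `t` and off-diagonal octonionic
entries `a`, `b`, `c` in the positions `(2, 3)`, `(3, 1)`, `(1, 2)`. -/
def ofCoords (r s t : ℝ) (a b c : Octonion) : H3O :=
  ⟨!![r • 1, c, star b; star c, s • 1, a; b, star a, t • 1], by
    rw [selfAdjoint.mem_iff]
    ext1 i j
    fin_cases i <;> fin_cases j <;> simp [Matrix.star_apply]⟩

theorem toMatrix_ofCoords (r s t : ℝ) (a b c : Octonion) :
    toMatrix (ofCoords r s t a b c)
      = !![r • 1, c, star b; star c, s • 1, a; b, star a, t • 1] := rfl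

theorem exists_ofCoords (x : H3O) : ∃ r s t a b c, x = ofCoords r s t a b c := by
  have h : ∀ i j, star (toMatrix x j i) = toMatrix x i j := fun i j =>
    congrFun (congrFun (conjTranspose_toMatrix x) i) j
  refine ⟨re (toMatrix x 0 0), re (toMatrix x 1 1), re (toMatrix x 2 2), toMatrix x 1 2,
    toMatrix x 2 0, toMatrix x 0 1, toMatrix_injective ?_⟩
  rw [toMatrix_ofCoords]
  ext1 i j
  fin_cases i <;> fin_cases j <;>
    simp [h, ← eq_re_smul_one_of_star_eq]

theorem tr_ofCoords (r s t : ℝ) (a b c : Octonion) :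
    tr (ofCoords r s t a b c) = r + s + t := by
  simp [tr, toMatrix_ofCoords, Matrix.trace, Fin.sum_univ_three, re_apply]

theorem ofCoords_add (r s t r' s' t' : ℝ) (a b c a' b' c' : Octonion) :
    ofCoords r s t a b c + ofCoords r' s' t' a' b' c'
      = ofCoords (r + r') (s + s') (t + t') (a + a') (b + b') (c + c') := by
  apply toMatrix_injective
  rw [map_add]
  ext1 i j
  fin_cases i <;> fin_cases j <;> simp [toMatrix_ofCoords, add_smul]

theorem smul_ofCoords (k r s t : ℝ) (a b c : Octonion) :
    k • ofCoords r s t a b c = ofCoords (k * r) (k * s) (k * t) (k • a) (k • b) (k • c) := by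
  apply toMatrix_injective
  rw [map_smul]
  ext1 i j
  fin_cases i <;> fin_cases j <;> simp [toMatrix_ofCoords, mul_smul]

theorem toMatrix_mul_self (x : H3O) : toMatrix (x * x) = toMatrix x * toMatrix x := by
  rw [toMatrix_mul, ← two_smul ℝ, smul_smul]; norm_num

theorem ofCoords_mul_self (r s t : ℝ) (a b c : Octonion) :
    ofCoords r s t a b c * ofCoords r s t a b c
      = ofCoords (r ^ 2 + normSq b + normSq c) (s ^ 2 + normSq c + normSq a)
          (t ^ 2 + normSq a + normSq b) (star (b * c) + (s + t) • a)
          (star (c * a) + (t + r) • b) (star (a * b) + (r + s) • c) := by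
  apply toMatrix_injective
  rw [toMatrix_mul_self]
  ext1 i j
  fin_cases i <;> fin_cases j <;>
    simp [toMatrix_ofCoords, Matrix.mul_apply, Fin.sum_univ_three, self_mul_star,
      star_mul_self] <;> module

/-- The identity matrix. -/
def unit : H3O := ofCoords 1 1 1 0 0 0

theorem toMatrix_unit : toMatrix unit = 1 := by
  ext1 i j
  fin_cases i <;> fin_cases j <;> simp [unit, toMatrix_ofCoords]

theorem tr_unit : tr unit = 3 := by
  rw [unit, tr_ofCoords]; norm_num

theorem unit_mul (x : H3O) : unit * x = x := by
  apply toMatrix_injective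
  rw [toMatrix_mul, toMatrix_unit, mul_one, one_mul, ← two_smul ℝ, smul_smul]
  norm_num

theorem adj_ofCoords (r s t : ℝ) (a b c : Octonion) :
    CubicForm.adj tr unit (ofCoords r s t a b c)
      = ofCoords (s * t - normSq a) (t * r - normSq b) (r * s - normSq c)
          (star (b * c) - r • a) (star (c * a) - s • b) (star (a * b) - t • c) := by
  rw [CubicForm.adj, ofCoords_mul_self, tr_ofCoords, tr_ofCoords, unit, sub_eq_add_neg,
    ← neg_smul, smul_ofCoords, smul_ofCoords, ofCoords_add, ofCoords_add]
  congr 1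
  · ring
  · ring
  · ring
  · module
  · module
  · module

theorem tr_mul_ofCoords (r s t r' s' t' : ℝ) (a b c a' b' c' : Octonion) :
    tr (ofCoords r s t a b c * ofCoords r' s' t' a' b' c')
      = r * r' + s * s' + t * t'
        + 2 * (re (a * star a') + re (b * star b') + re (c * star c')) := by
  simp only [tr, LinearMap.comp_apply, toMatrix_mul, toMatrix_ofCoords]
  simp [Matrix.trace, Fin.sum_univ_three, re_apply]
  ring

theorem norm_ofCoords (r s t : ℝ) (a b c : Octonion) :
    CubicForm.norm tr unit (ofCoords r s t a b c)
      = r * s * t - r * normSq a - s * normSq b - t * normSq c + 2 * re (a * b * c) := by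
  rw [CubicForm.norm, adj_ofCoords, tr_mul_ofCoords, re_star_mul_sub_mul_star,
    re_star_mul_sub_mul_star, re_star_mul_sub_mul_star, re_mul_cycle b c a, re_mul_cycle a b c]
  ring

/-- The adjoint identity, from which both the Jordan and the Cayley–Hamilton identities of `𝔥₃(𝕆)`
follow. It reduces to the Moufang identity and the multiplicativity of the norm. -/
theorem adj_adj (x : H3O) : CubicForm.adj tr unit (CubicForm.adj tr unit x)
    = CubicForm.norm tr unit x • x := by
  obtain ⟨r, s, t, a, b, c, rfl⟩ := exists_ofCoords x
  rw [norm_ofCoords, adj_ofCoords, adj_ofCoords, smul_ofCoords, star_mul_adjoint_entries,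
    star_mul_adjoint_entries, star_mul_adjoint_entries]
  simp only [normSq_star_mul_sub]
  have h1 := re_mul_cycle a b c
  have h2 := re_mul_cycle b c a
  rw [h2, h1]
  congr 1
  · ring
  · ring
  · ring
  · congr 1; ring
  · congr 1; ring

theorem eq_zero_of_tr_mul_self (x : H3O) (h : tr (x * x) = 0) : x = 0 := by
  obtain ⟨r, s, t, a, b, c, rfl⟩ := exists_ofCoords x
  rw [ofCoords_mul_self, tr_ofCoords] at h
  have ha := normSq_nonneg a
  have hb := normSq_nonneg b
  have hc := normSq_nonneg c
  have hr : r = 0 := by nlinarith [sq_nonneg r, sq_nonneg s, sq_nonneg t]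
  have hs : s = 0 := by nlinarith [sq_nonneg r, sq_nonneg s, sq_nonneg t]
  have ht : t = 0 := by nlinarith [sq_nonneg r, sq_nonneg s, sq_nonneg t]
  subst hr hs ht
  obtain rfl := normSq_eq_zero (x := a) (by linarith)
  obtain rfl := normSq_eq_zero (x := b) (by linarith)
  obtain rfl := normSq_eq_zero (x := c) (by linarith)
  simpa using (smul_ofCoords 0 0 0 0 0 0 0).symm

theorem jordan_identity (x y : H3O) : x * (x * x * y) = x * x * (x * y) :=
  CubicForm.jordan_identity unit_mul tr_unit tr_mul_assoc eq_zero_of_tr_mul_self adj_adj x y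

instance : IsCommJordan H3O where
  lmul_comm_rmul_rmul a b := by
    rw [mul_comm (a * b), ← jordan_identity, mul_comm b]

theorem linearizedJordan : LinearizedJordan H3O :=
  haveI : IsAddTorsionFree H3O := .of_isTorsionFree ℝ H3O
  linearizedJordan_of_isCommJordan

theorem mul_self_of_mem (P : cayleyPlane) : (P : H3O) * P = P :=
  toMatrix_injective (by rw [toMatrix_mul_self]; exact P.2.1)

theorem mul_of_mem_tangentSpace {P : cayleyPlane} {x : H3O} (hx : x ∈ tangentSpace P) :
    (P : H3O) * x = (1 / 2 : ℝ) • x := by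
  have h : (2 : ℝ) • ((P : H3O) * x) = x := hx
  conv_rhs => rw [← h, smul_smul]
  norm_num

theorem mul_self_mul_self_of_mem_tangentSpace {P : cayleyPlane} {x : H3O}
    (hx : x ∈ tangentSpace P) : x * x * x = (tr (x * x) / 2) • x := by
  have hP := mul_self_of_mem P
  have hPx := mul_of_mem_tangentSpace hx
  have hxP : x * (P : H3O) = (1 / 2 : ℝ) • x := by rw [mul_comm, hPx]
  -- The trace form makes the Peirce spaces of `P` orthogonal.
  have h1 : tr x = 0 := by
    have h := tr_mul_assoc P P x
    rw [hP, hPx, mul_smul_comm, hPx, map_smul, map_smul, map_smul] at h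
    simp only [smul_eq_mul] at h
    linarith
  have h3 : tr (x * x * x) = 0 := by
    have e1 := tr_mul_assoc (x * x) P x
    have e2 := tr_mul_assoc (x * x * P) P x
    rw [mul_comm (x * x * P) P, mul_comm (x * x) P,
      linearizedJordan.mul_mul_sq hP hPx] at e2
    rw [mul_comm (x * x) P] at e1
    rw [hPx, mul_smul_comm, map_smul, smul_eq_mul] at e1 e2
    linarith
  exact CubicForm.mul_self_mul_self unit_mul tr_unit tr_mul_assoc eq_zero_of_tr_mul_self adj_adj
    h1 h3

/-- The linearisation of `x³ = ½ tr(x²) x` on the tangent space. -/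
theorem mul_self_mul_add_of_mem_tangentSpace {P : cayleyPlane} {x y : H3O}
    (hx : x ∈ tangentSpace P) (hy : y ∈ tangentSpace P) :
    x * x * y + (2 : ℝ) • (x * y * x) = (tr (x * x) / 2) • y + tr (x * y) • x := by
  have h1 := mul_self_mul_self_of_mem_tangentSpace (add_mem hx hy)
  have h2 := mul_self_mul_self_of_mem_tangentSpace (sub_mem hx hy)
  have h3 := mul_self_mul_self_of_mem_tangentSpace hy
  simp only [add_mul, mul_add, sub_mul, mul_sub, map_add, map_sub, mul_comm y x] at h1 h2
  linear_combination (norm := module) (1 / 2 : ℝ) • h1 - (1 / 2 : ℝ) • h2 - h3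

end H3O

/-! ### The complexification -/

namespace H3OC

open H3O

instance : NonUnitalNonAssocCommRing H3OC where
  mul_comm x y := by
    induction x using TensorProduct.induction_on with
    | zero => rw [zero_mul, mul_zero]
    | add x₁ x₂ h₁ h₂ => rw [add_mul, mul_add, h₁, h₂]
    | tmul k a =>
      induction y using TensorProduct.induction_on with
      | zero => rw [zero_mul, mul_zero]
      | add y₁ y₂ h₁ h₂ => rw [add_mul, mul_add, h₁, h₂]
      | tmul l b =>
        rw [Algebra.TensorProduct.tmul_mul_tmul, Algebra.TensorProduct.tmul_mul_tmul,
          mul_comm k, mul_comm a]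

/-- The linearised Jordan identity is additive in each variable, hence extends to the
complexification. -/
theorem linearizedJordan : LinearizedJordan H3OC := by
  intro a b c d
  induction a using TensorProduct.induction_on with
  | zero => simp
  | add a₁ a₂ h₁ h₂ =>
    simp only [add_mul, mul_add]
    linear_combination (norm := abel) h₁ + h₂
  | tmul i a =>
  induction b using TensorProduct.induction_on with
  | zero => simp
  | add b₁ b₂ h₁ h₂ =>
    simp only [add_mul, mul_add]
    linear_combination (norm := abel) h₁ + h₂
  | tmul j b =>
  induction c using TensorProduct.induction_on with
  | zero => simp
  | add c₁ c₂ h₁ h₂ =>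
    simp only [add_mul, mul_add]
    linear_combination (norm := abel) h₁ + h₂
  | tmul k c =>
  induction d using TensorProduct.induction_on with
  | zero => simp
  | add d₁ d₂ h₁ h₂ =>
    simp only [mul_add]
    linear_combination (norm := abel) h₁ + h₂
  | tmul l d =>
    have h := congrArg (fun x => (i * j * (k * l)) ⊗ₜ[ℝ] x) (H3O.linearizedJordan a b c d)
    simp only [TensorProduct.tmul_add] at h
    simp only [Algebra.TensorProduct.tmul_mul_tmul]
    rw [show j * k * (i * l) = i * j * (k * l) by ring,
      show k * i * (j * l) = i * j * (k * l) by ring, h,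
      show k * (i * j * l) = i * j * (k * l) by ring,
      show i * (j * k * l) = i * j * (k * l) by ring,
      show j * (k * i * l) = i * j * (k * l) by ring]

/-- Real and imaginary parts of an element of a complexified subspace. -/
theorem exists_re_im {p : Submodule ℝ H3O} {Z : H3OC} (hZ : Z ∈ p.baseChange ℂ) :
    ∃ a ∈ p, ∃ b ∈ p, Z = (1 : ℂ) ⊗ₜ[ℝ] a + Complex.I ⊗ₜ[ℝ] b := by
  rw [Submodule.baseChange_eq_span] at hZ
  induction hZ using Submodule.span_induction with
  | zero => exact ⟨0, zero_mem _, 0, zero_mem _, by simp⟩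
  | mem Z hZ =>
    obtain ⟨z, hz, rfl⟩ := hZ
    exact ⟨z, hz, 0, zero_mem _, by simp⟩
  | add Z W _ _ h1 h2 =>
    obtain ⟨a, ha, b, hb, rfl⟩ := h1
    obtain ⟨a', ha', b', hb', rfl⟩ := h2
    refine ⟨a + a', add_mem ha ha', b + b', add_mem hb hb', ?_⟩
    simp only [TensorProduct.tmul_add]
    abel
  | smul k Z _ h =>
    obtain ⟨a, ha, b, hb, rfl⟩ := h
    obtain ⟨x, y, rfl⟩ : ∃ x y : ℝ, k = x + y * Complex.I :=
      ⟨k.re, k.im, (Complex.re_add_im k).symm⟩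
    refine ⟨x • a - y • b, sub_mem (p.smul_mem _ ha) (p.smul_mem _ hb),
      x • b + y • a, add_mem (p.smul_mem _ hb) (p.smul_mem _ ha), ?_⟩
    have h : (x + y * Complex.I) * Complex.I = x * Complex.I - y := by
      linear_combination (y : ℂ) * Complex.I_mul_I
    simp only [TensorProduct.tmul_add, TensorProduct.tmul_sub, TensorProduct.tmul_smul, smul_add,
      TensorProduct.smul_tmul', smul_eq_mul, mul_one, Complex.real_smul, h,
      TensorProduct.add_tmul, TensorProduct.sub_tmul]
    abel

theorem tr_tmul (k : ℂ) (a : H3O) : tr (k ⊗ₜ[ℝ] a) = H3O.tr a • k := by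
  simp [tr]

/-- The cube of an isotropic tangent vector vanishes: the identity `x³ = ½ tr(x²) x` on the real
tangent space, linearised and extended to complex coefficients, becomes `Z³ = ½ tr(Z²) Z`. -/
theorem mul_self_mul_self_eq_zero {P : cayleyPlane} {Z : H3OC} (hZ : Z ∈ tangentSpace P)
    (h : tr (Z * Z) = 0) : Z * Z * Z = 0 := by
  obtain ⟨a, ha, b, hb, rfl⟩ := exists_re_im hZ
  have hsq : ((1 : ℂ) ⊗ₜ[ℝ] a + Complex.I ⊗ₜ[ℝ] b) * ((1 : ℂ) ⊗ₜ[ℝ] a + Complex.I ⊗ₜ[ℝ] b)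
      = (1 : ℂ) ⊗ₜ[ℝ] (a * a - b * b) + Complex.I ⊗ₜ[ℝ] ((2 : ℝ) • (a * b)) := by
    simp only [add_mul, mul_add, Algebra.TensorProduct.tmul_mul_tmul, one_mul, mul_one,
      Complex.I_mul_I, mul_comm b a, TensorProduct.tmul_sub, TensorProduct.neg_tmul, two_smul,
      TensorProduct.tmul_add]
    abel
  rw [hsq, map_add, tr_tmul, tr_tmul] at h
  have hre : H3O.tr (a * a) = H3O.tr (b * b) := by
    have := congrArg Complex.re h
    simp at this
    linarith
  have him : H3O.tr (a * b) = 0 := by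
    have := congrArg Complex.im h
    simpa using this
  have e1 := mul_self_mul_self_of_mem_tangentSpace ha
  have e2 := mul_self_mul_self_of_mem_tangentSpace hb
  have e3 := mul_self_mul_add_of_mem_tangentSpace ha hb
  have e4 := mul_self_mul_add_of_mem_tangentSpace hb ha
  rw [mul_comm b a] at e4
  rw [him, hre] at e3
  rw [him] at e4
  rw [hre] at e1
  have h1 : (a * a - b * b) * a - (2 : ℝ) • (a * b) * b = 0 := by
    rw [sub_mul, smul_mul_assoc]
    linear_combination (norm := module) e1 - e4
  have h2 : (a * a - b * b) * b + (2 : ℝ) • (a * b) * a = 0 := by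
    rw [sub_mul, smul_mul_assoc]
    linear_combination (norm := module) e3 - e2
  rw [hsq]
  have : ((1 : ℂ) ⊗ₜ[ℝ] (a * a - b * b) + Complex.I ⊗ₜ[ℝ] ((2 : ℝ) • (a * b)))
      * ((1 : ℂ) ⊗ₜ[ℝ] a + Complex.I ⊗ₜ[ℝ] b)
      = (1 : ℂ) ⊗ₜ[ℝ] ((a * a - b * b) * a - (2 : ℝ) • (a * b) * b)
        + Complex.I ⊗ₜ[ℝ] ((a * a - b * b) * b + (2 : ℝ) • (a * b) * a) := by
    generalize a * a - b * b = x
    generalize (2 : ℝ) • (a * b) = y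
    simp only [add_mul, mul_add, Algebra.TensorProduct.tmul_mul_tmul, one_mul, mul_one,
      Complex.I_mul_I, TensorProduct.tmul_sub, TensorProduct.neg_tmul, TensorProduct.tmul_add]
    abel
  rw [this, h1, h2, TensorProduct.tmul_zero, TensorProduct.tmul_zero, add_zero]

theorem ofPoint_mul_self (P : cayleyPlane) : ofPoint P * ofPoint P = ofPoint P := by
  rw [ofPoint, Algebra.TensorProduct.tmul_mul_tmul, mul_one, mul_self_of_mem]

theorem ofPoint_mul {P : cayleyPlane} {Z : H3OC} (hZ : Z ∈ tangentSpace P) :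
    ofPoint P * Z = (1 / 2 : ℂ) • Z := by
  obtain ⟨a, ha, b, hb, rfl⟩ := exists_re_im hZ
  rw [ofPoint, mul_add, Algebra.TensorProduct.tmul_mul_tmul, Algebra.TensorProduct.tmul_mul_tmul,
    mul_of_mem_tangentSpace ha, mul_of_mem_tangentSpace hb, smul_add, ← TensorProduct.smul_tmul,
    ← TensorProduct.smul_tmul, TensorProduct.smul_tmul', TensorProduct.smul_tmul']
  norm_num [Complex.real_smul]

theorem hatAux_eq (P : cayleyPlane) (Z : H3OC) :
    hatAux P Z = (-4 : ℂ) • LinearMap.mulLeft ℂ Z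
      + (4 : ℂ) • (LinearMap.mulLeft ℂ Z * LinearMap.mulLeft ℂ (ofPoint P))
      + (4 : ℂ) • (LinearMap.mulLeft ℂ (ofPoint P) * LinearMap.mulLeft ℂ Z) := rfl

theorem hatAux_pow_five {P : cayleyPlane} {Z : H3OC} (hZ : Z ∈ tangentSpace P)
    (h : tr (Z * Z) = 0) : hatAux P Z ^ 5 = 0 := by
  rw [hatAux_eq]
  exact linearizedJordan.hat_pow_five (ofPoint_mul_self P) (ofPoint_mul hZ)
    (mul_self_mul_self_eq_zero hZ h)

end H3OC

end

theorem mainTheorem4 (P : H3O.cayleyPlane) (Z : H3OC.tangentSpace P)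
    (hZ : H3OC.tr ((Z : H3OC) * (Z : H3OC)) = 0) :
    IsNilpotent (H3OC.hat P Z) ∧ nilpotencyClass (H3OC.hat P Z) ≤ 5 := by
  have h : H3OC.hat P Z ^ 5 = 0 := by
    ext X : 2
    rw [H3OC.hat, Module.End.pow_restrict]
    simp [H3OC.hatAux_pow_five Z.2 hZ]
  exact ⟨⟨5, h⟩, Nat.sInf_le h⟩
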